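/- Let $N\ge 1$, let $\Sigma\in\mathbb R^{N\times N}$ be symmetric positive definite, and let $X$ be an $\mathbb R^N$-valued Gaussian random vector on a probability space $(\Omega,\mathcal F,\mathbb P)$ with zero mean and covariance matrix $\Sigma$, hence with density $$\phi(x;\Sigma)=(2\pi)^{-N/2}(\det\Sigma)^{-1/2}\exp\left(-\tfrac12 x^T\Sigma^{-1}x\right).$$ For a multi-index $j\in\mathbb N_0^N$ with $|j|=j_1+\dots+j_N$ define the Hermite polynomial and its standardized version $$H_j(x;\Sigma)=\frac{(-1)^{|j|}}{\phi(x;\Sigma)}\,\frac{\partial^{|j|}\phi(x;\Sigma)}{\partial x_1^{j_1}\cdots\partial x_N^{j_N}},\qquad \Psi_j(x;\Sigma)=\frac{H_j(x;\Sigma)}{\sqrt{\int_{\mathbb R^N}H_j(z;\Sigma)^2\,\phi(z;\Sigma)\,dz}}.$$ Let $y:\mathbb R^N\to\mathbb R$ be measurable with $\mathbb E[y(X)^2]<\infty$. Then: (1) All $\Psi_j(X;\Sigma)$ are square-integrable, and there are coefficients $C_j\in\mathbb R$, $j\in\mathbb N_0^N$, solving the system $$\sum_{k\in\mathbb N_0^N,\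 |k|=|j|}C_k\,\mathbb E[\Psi_j(X;\Sigma)\Psi_k(X;\Sigma)]=\mathbb E[y(X)\Psi_j(X;\Sigma)],\qquad j\in\mathbb N_0^N,\tag{$*$}$$ which consists of uncoupled finite linear systems, one for each degree $|j|$. (2) For every family $(C_j)$ that solves $(*)$, the partial sums $\sum_{|j|\le m}C_j\Psi_j(X;\Sigma)$ converge to $y(X)$ as $m\to\infty$ in mean square, and hence also in probability and in distribution. Conversely, if for some real family $(C_j)$ these partial sums converge to $y(X)$ in mean square, then $(C_j)$ solves $(*)$. -/

import Mathlib

open MeasureTheory ProbabilityTheory Filter Topology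
open scoped Matrix

noncomputable section

/-- The centered Gaussian density on `ℝ^N` with covariance matrix `S`:
`φ(x; S) = (2π)^(-N/2) (det S)^(-1/2) exp (-½ xᵀ S⁻¹ x)`. -/
def gaussianDensity {N : ℕ} (S : Matrix (Fin N) (Fin N) ℝ) (x : EuclideanSpace ℝ (Fin N)) : ℝ :=
  (2 * Real.pi) ^ (-(N : ℝ) / 2) * S.det ^ (-(1 / 2) : ℝ) *
    Real.exp (-(1 / 2) * ((fun i => x i) ⬝ᵥ (S⁻¹ *ᵥ (fun i => x i))))

/-- The partial derivative `∂f/∂x_i`. -/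
def partialDerivative {N : ℕ} (i : Fin N) (f : EuclideanSpace ℝ (Fin N) → ℝ) :
    EuclideanSpace ℝ (Fin N) → ℝ :=
  fun x => lineDeriv ℝ f x (EuclideanSpace.single i 1)

/-- The mixed partial derivative
`(∂/∂x)^j f = ∂^|j| f / ∂x_1^(j_1) ⋯ ∂x_N^(j_N)` for a multi-index `j`. -/
def multiDerivative {N : ℕ} (j : Fin N → ℕ) (f : EuclideanSpace ℝ (Fin N) → ℝ) :
    EuclideanSpace ℝ (Fin N) → ℝ :=
  (List.finRange N).foldr (fun i g => (partialDerivative i)^[j i] g) f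

/-- The multi-indices `j` with `|j| = j_1 + ⋯ + j_N = l`. -/
def multiIndices (N l : ℕ) : Finset (Fin N → ℕ) :=
  Finset.piAntidiag Finset.univ l

/-- The multivariate Hermite polynomial
`H_j(x; S) = (-1)^|j| φ(x; S)⁻¹ (∂/∂x)^j φ(x; S)`. -/
def hermiteH {N : ℕ} (S : Matrix (Fin N) (Fin N) ℝ) (j : Fin N → ℕ)
    (x : EuclideanSpace ℝ (Fin N)) : ℝ :=
  (-1) ^ (∑ i, j i) / gaussianDensity S x * multiDerivative j (gaussianDensity S) x

/-- The standardized multivariate Hermite polynomial `Ψ_j = H_j / √(H_j, H_j)`, where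
`(P, Q) = ∫ P(x) Q(x) φ(x; S) dx`. -/
def hermitePsi {N : ℕ} (S : Matrix (Fin N) (Fin N) ℝ) (j : Fin N → ℕ)
    (x : EuclideanSpace ℝ (Fin N)) : ℝ :=
  hermiteH S j x / √(∫ z, hermiteH S j z * hermiteH S j z * gaussianDensity S z)

/-- The partial sum `∑_{|j| ≤ m} C_j Ψ_j(x; S)`. -/
def pcePartialSum {N : ℕ} (S : Matrix (Fin N) (Fin N) ℝ) (C : (Fin N → ℕ) → ℝ) (m : ℕ)
    (x : EuclideanSpace ℝ (Fin N)) : ℝ :=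
  ∑ l ∈ Finset.range (m + 1), ∑ j ∈ multiIndices N l, C j * hermitePsi S j x

/-- The family `C` satisfies, for every multi-index `j`, the equation
`∑_{|k| = |j|} C_k E[Ψ_j(X) Ψ_k(X)] = E[y(X) Ψ_j(X)]`. -/
def SolvesCoefficientSystem {N : ℕ} {Ω : Type*} [MeasurableSpace Ω] (P : Measure Ω)
    (S : Matrix (Fin N) (Fin N) ℝ) (X : Ω → EuclideanSpace ℝ (Fin N))
    (y : EuclideanSpace ℝ (Fin N) → ℝ) (C : (Fin N → ℕ) → ℝ) : Prop :=
  ∀ j : Fin N → ℕ,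
    ∑ k ∈ multiIndices N (∑ i, j i),
        C k * ∫ ω, hermitePsi S j (X ω) * hermitePsi S k (X ω) ∂P =
      ∫ ω, y (X ω) * hermitePsi S j (X ω) ∂P

end

/-! Everything is transported to `L²(γ)`, where γ is the centered Gaussian law with covariance `S`.
Put `D_i p = ∂_i p - (S⁻¹x)_i p`, so that `∂_i (p φ) = (D_i p) φ`. Up to sign, `H_j` is the
polynomial obtained from 1 by applying the commuting operators `D_i`, each `j_i` times.

Integration by parts makes `D_i` minus the adjoint of `∂_i` in `L²(γ)` (`integral_mul_hermiteOp`),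
so `H_j` is orthogonal to every polynomial of degree below `|j|`. Different degrees are therefore
orthogonal; inside one degree they need not be, which is why a Gram block remains. Since `S⁻¹` is
invertible, the `H_j` with `|j| ≤ m` span all polynomials of degree at most `m`
(`mem_span_hermitePoly`). Polynomials are dense in `L²(γ)`: if `f` is orthogonal to them, expanding
`exp(i⟨x,t⟩)` in powers shows that the Fourier transform of `f γ` vanishes
(`ae_eq_zero_of_integral_mul_pow_dual_eq_zero`).

The rest is Hilbert space geometry (`gram_system_iff_tendsto`, `exists_gram_solution`). The system
says exactly that each partial sum is the orthogonal projection of `y` onto the polynomials of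
degree at most `m`, and these projections converge to `y` by density. Conversely, pairing a
convergent expansion with `Ψ_j` returns the equation for `j`. Projecting onto the span of each
degree gives a solution. -/

/-! ### Algebra of Hermite polynomials -/

section HermiteAlgebra

open MvPolynomial

variable {N : ℕ}

/-- The linear form `∑ k, A i k * x k`, as a polynomial. -/
noncomputable def rowForm (A : Matrix (Fin N) (Fin N) ℝ) (i : Fin N) : MvPolynomial (Fin N) ℝ :=
  ∑ k, C (A i k) * X k

/-- The operator `p ↦ ∂ᵢ p - (A x)ᵢ p`, which for symmetric `A` is `∂ᵢ`
conjugated by `exp (-½ xᵀ A x)`. -/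
noncomputable def hermiteOp (A : Matrix (Fin N) (Fin N) ℝ) (i : Fin N) :
    Module.End ℝ (MvPolynomial (Fin N) ℝ) :=
  (pderiv i).toLinearMap - LinearMap.mulLeft ℝ (rowForm A i)

lemma hermiteOp_apply (A : Matrix (Fin N) (Fin N) ℝ) (i : Fin N) (p : MvPolynomial (Fin N) ℝ) :
    hermiteOp A i p = pderiv i p - rowForm A i * p := rfl

/-- The polynomial obtained from `1` by applying `hermiteOp A i` exactly `j i` times. -/
noncomputable def hermitePoly (A : Matrix (Fin N) (Fin N) ℝ) (j : Fin N → ℕ) :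
    MvPolynomial (Fin N) ℝ :=
  (List.finRange N).foldr (fun i p => (hermiteOp A i)^[j i] p) 1

lemma pderiv_rowForm (A : Matrix (Fin N) (Fin N) ℝ) (i k : Fin N) :
    pderiv i (rowForm A k) = C (A k i) := by
  simp [rowForm, pderiv_X, Pi.single_apply]

lemma pderiv_comm (i k : Fin N) (p : MvPolynomial (Fin N) ℝ) :
    pderiv i (pderiv k p) = pderiv k (pderiv i p) := by
  have h : ⁅(pderiv i : Derivation ℝ (MvPolynomial (Fin N) ℝ) (MvPolynomial (Fin N) ℝ)),
      (pderiv k : Derivation ℝ (MvPolynomial (Fin N) ℝ) (MvPolynomial (Fin N) ℝ))⁆ = 0 := by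
    ext l
    simp [Derivation.commutator_apply, pderiv_X, Pi.single_apply, apply_ite]
  have := congrArg (fun D => D p) h
  simpa [Derivation.commutator_apply, sub_eq_zero] using this

/-- In the composition, the only term not visibly symmetric in `i` and `k` is `-A k i * p`, and
symmetry of `A` settles it. -/
lemma hermiteOp_commute {A : Matrix (Fin N) (Fin N) ℝ} (hA : A.IsSymm) (i k : Fin N) :
    Function.Commute (hermiteOp A i) (hermiteOp A k) := by
  intro p
  simp only [hermiteOp_apply, map_sub, pderiv_mul, pderiv_rowForm, pderiv_comm i k, hA.apply]
  rw [← hA.apply i k]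
  ring

/-- The extra operator appears at the single position of `i` in the list and is moved to the front
by commutativity. The case `i ∉ L` is carried along for the tail behind that position. -/
lemma hermiteOp_foldr {A : Matrix (Fin N) (Fin N) ℝ} (hA : A.IsSymm) (i : Fin N) (j : Fin N → ℕ)
    (p : MvPolynomial (Fin N) ℝ) (L : List (Fin N)) (hL : L.Nodup) :
    (i ∉ L → L.foldr (fun k p => (hermiteOp A k)^[(j + Pi.single i 1 : Fin N → ℕ) k] p) p =
      L.foldr (fun k p => (hermiteOp A k)^[j k] p) p) ∧
    (i ∈ L → L.foldr (fun k p => (hermiteOp A k)^[(j + Pi.single i 1 : Fin N → ℕ) k] p) p =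
      hermiteOp A i (L.foldr (fun k p => (hermiteOp A k)^[j k] p) p)) := by
  induction L with
  | nil => simp
  | cons k L ih =>
    obtain ⟨hk, hL⟩ := List.nodup_cons.1 hL
    obtain ⟨ih1, ih2⟩ := ih hL
    by_cases hik : i = k
    · subst hik
      refine ⟨by simp, fun _ => ?_⟩
      rw [List.foldr_cons, ih1 hk, List.foldr_cons, Pi.add_apply, Pi.single_eq_same,
        Function.iterate_succ_apply']
    · have h0 : (Pi.single i 1 : Fin N → ℕ) k = 0 := Pi.single_eq_of_ne (Ne.symm hik) _
      simp only [List.mem_cons, hik, false_or, List.foldr_cons, Pi.add_apply, h0, add_zero]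
      refine ⟨fun h => ?_, fun h => ?_⟩
      · simpa only [Pi.add_apply] using congrArg _ (ih1 h)
      · have := congrArg (hermiteOp A k)^[j k] (ih2 h)
        simp only [Pi.add_apply] at this
        rw [this]
        exact (((hermiteOp_commute hA i k).iterate_right (j k)) _).symm

lemma hermitePoly_add_single {A : Matrix (Fin N) (Fin N) ℝ} (hA : A.IsSymm) (i : Fin N)
    (j : Fin N → ℕ) : hermitePoly A (j + Pi.single i 1) = hermiteOp A i (hermitePoly A j) :=
  (hermiteOp_foldr hA i j 1 _ (List.nodup_finRange N)).2 (List.mem_finRange i)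

lemma hermitePoly_zero (A : Matrix (Fin N) (Fin N) ℝ) : hermitePoly A 0 = 1 := by
  unfold hermitePoly
  induction List.finRange N with
  | nil => rfl
  | cons k L ih => simp

lemma exists_add_single_of_sum_eq_succ {j : Fin N → ℕ} {n : ℕ} (hj : ∑ i, j i = n + 1) :
    ∃ (i : Fin N) (j' : Fin N → ℕ), j = j' + Pi.single i 1 ∧ ∑ i, j' i = n := by
  obtain ⟨i, -, hi⟩ := Finset.exists_ne_zero_of_sum_ne_zero (hj.trans_ne n.succ_ne_zero)
  have h : j = (j - Pi.single i 1) + Pi.single i 1 := by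
    ext k
    by_cases hk : k = i
    · subst hk; simp; omega
    · simp [Pi.single_eq_of_ne hk]
  refine ⟨i, _, h, ?_⟩
  rw [h] at hj
  simp only [Pi.add_apply, Finset.sum_add_distrib, Finset.sum_pi_single',
    Finset.mem_univ, if_true] at hj
  simpa using hj

lemma totalDegree_pderiv_le (i : Fin N) (p : MvPolynomial (Fin N) ℝ) :
    (pderiv i p).totalDegree ≤ p.totalDegree - 1 := by
  conv_lhs => rw [p.as_sum, map_sum]
  refine totalDegree_finsetSum_le fun s hs => ?_
  rw [pderiv_monomial]
  by_cases h0 : coeff s p * (s i : ℝ) = 0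
  · simp [h0]
  refine (totalDegree_monomial_le _ _).trans ?_
  have hsi : s i ≠ 0 := by
    intro h; simp [h] at h0
  have h1 := le_totalDegree hs
  have h2 : s = (s - Finsupp.single i 1) + Finsupp.single i 1 := by
    ext k
    by_cases hk : k = i
    · subst hk; simp; omega
    · simp [Finsupp.single_eq_of_ne hk]
  rw [h2, Finsupp.sum_add_index' (fun _ => rfl) (fun _ _ _ => rfl)] at h1
  simp only [Finsupp.sum_single_index] at h1
  exact Nat.le_sub_one_of_lt h1

lemma rowForm_mul_totalDegree_le {A : Matrix (Fin N) (Fin N) ℝ} (i : Fin N) {p : MvPolynomial (Fin N) ℝ}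
    {n : ℕ} (hp : p.totalDegree ≤ n) : (rowForm A i * p).totalDegree ≤ n + 1 := by
  refine (totalDegree_mul _ _).trans ?_
  rw [add_comm]
  refine Nat.add_le_add hp (totalDegree_finsetSum_le fun k _ => ?_)
  refine (totalDegree_mul _ _).trans ?_
  simp [totalDegree_C, totalDegree_X]

lemma hermiteOp_totalDegree_le {A : Matrix (Fin N) (Fin N) ℝ} (i : Fin N)
    {p : MvPolynomial (Fin N) ℝ} {n : ℕ} (hp : p.totalDegree ≤ n) :
    (hermiteOp A i p).totalDegree ≤ n + 1 := by
  rw [hermiteOp_apply]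
  refine (totalDegree_sub _ _).trans (max_le ?_ (rowForm_mul_totalDegree_le i hp))
  have := totalDegree_pderiv_le i p
  omega

lemma hermitePoly_totalDegree_le {A : Matrix (Fin N) (Fin N) ℝ} (hA : A.IsSymm) (j : Fin N → ℕ) :
    (hermitePoly A j).totalDegree ≤ ∑ i, j i := by
  induction hn : ∑ i, j i generalizing j with
  | zero =>
    obtain rfl : j = 0 := by
      ext i; simpa using (Finset.sum_eq_zero_iff.1 hn) i (Finset.mem_univ i)
    simp [hermitePoly_zero]
  | succ n ih =>
    obtain ⟨i, j', rfl, hj'⟩ := exists_add_single_of_sum_eq_succ hn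
    rw [hermitePoly_add_single hA]
    exact hermiteOp_totalDegree_le i (ih j' hj')

/-- If `hermiteOp A i` is minus the adjoint of `∂ᵢ` for a bilinear form, then the Hermite
polynomials are orthogonal to all polynomials of lower degree. -/
lemma hermitePoly_orthogonal {A : Matrix (Fin N) (Fin N) ℝ} (hA : A.IsSymm)
    (B : MvPolynomial (Fin N) ℝ →ₗ[ℝ] MvPolynomial (Fin N) ℝ →ₗ[ℝ] ℝ)
    (hB : ∀ i p q, B q (hermiteOp A i p) = - B (pderiv i q) p) (j : Fin N → ℕ)
    (q : MvPolynomial (Fin N) ℝ) (hq : q.totalDegree < ∑ i, j i) :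
    B q (hermitePoly A j) = 0 := by
  induction hn : ∑ i, j i generalizing j q with
  | zero => omega
  | succ n ih =>
    obtain ⟨i, j', rfl, hj'⟩ := exists_add_single_of_sum_eq_succ hn
    rw [hermitePoly_add_single hA, hB, neg_eq_zero]
    -- For constant `q` the truncated bound `totalDegree - 1` gives no decrease, but then the
    -- derivative is zero.
    by_cases h0 : q.totalDegree = 0
    · rw [totalDegree_eq_zero_iff_eq_C.1 h0]; simp
    · have := totalDegree_pderiv_le i q
      exact ih j' _ (by omega) hj'

/-- Inverting `A` gives `x_k = ∑ S k i (A x)_i`, and `(A x)_i q = ∂_i q - D_i q`. Hence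
multiplication by a coordinate raises the level of the span by at most one, and monomials are built
up coordinate by coordinate. -/
lemma mem_span_hermitePoly {A S : Matrix (Fin N) (Fin N) ℝ} (hA : A.IsSymm) (hSA : S * A = 1)
    (m : ℕ) (p : MvPolynomial (Fin N) ℝ) (hp : p.totalDegree ≤ m) :
    p ∈ Submodule.span ℝ (hermitePoly A '' {j | ∑ i, j i ≤ m}) := by
  induction m generalizing p with
  | zero =>
    rw [totalDegree_eq_zero_iff_eq_C.1 (Nat.le_zero.1 hp)]
    have h1 : (1 : MvPolynomial (Fin N) ℝ) ∈
        Submodule.span ℝ (hermitePoly A '' {j | ∑ i, j i ≤ 0}) :=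
      Submodule.subset_span ⟨0, by simp, hermitePoly_zero A⟩
    simpa [smul_eq_C_mul] using Submodule.smul_mem _ (coeff 0 p) h1
  | succ m ih =>
    set V := Submodule.span ℝ (hermitePoly A '' {j | ∑ i, j i ≤ m + 1}) with hV
    have hmono : ∀ q : MvPolynomial (Fin N) ℝ, q.totalDegree ≤ m → q ∈ V := fun q hq =>
      Submodule.span_mono (Set.image_mono fun j (hj : _ ≤ _) => Nat.le_succ_of_le hj) (ih q hq)
    have hop : ∀ i, ∀ q : MvPolynomial (Fin N) ℝ, q.totalDegree ≤ m → hermiteOp A i q ∈ V := by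
      intro i q hq
      have := Submodule.mem_map_of_mem (f := hermiteOp A i) (ih q hq)
      rw [Submodule.map_span] at this
      refine Submodule.span_mono ?_ this
      rintro _ ⟨_, ⟨j, hj, rfl⟩, rfl⟩
      refine ⟨j + Pi.single i 1, ?_, hermitePoly_add_single hA i j⟩
      simpa [Finset.sum_add_distrib] using hj
    have hrow : ∀ i, ∀ q : MvPolynomial (Fin N) ℝ, q.totalDegree ≤ m → rowForm A i * q ∈ V := by
      intro i q hq
      have : rowForm A i * q = pderiv i q - hermiteOp A i q := by rw [hermiteOp_apply]; ring
      rw [this]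
      refine V.sub_mem (hmono _ ?_) (hop i q hq)
      have := totalDegree_pderiv_le i q
      omega
    have hX : ∀ k, ∀ q : MvPolynomial (Fin N) ℝ, q.totalDegree ≤ m → X k * q ∈ V := by
      intro k q hq
      have hXk : (X k : MvPolynomial (Fin N) ℝ) = ∑ i, C (S k i) * rowForm A i := by
        have h : ∀ l, ∑ i, S k i * A i l = (1 : Matrix (Fin N) (Fin N) ℝ) k l := fun l => by
          rw [← hSA, Matrix.mul_apply]
        simp_rw [rowForm, Finset.mul_sum, ← mul_assoc, ← C_mul]
        rw [Finset.sum_comm]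
        simp_rw [← Finset.sum_mul, ← map_sum, h, Matrix.one_apply]
        simp
      rw [hXk, Finset.sum_mul]
      refine V.sum_mem fun i _ => ?_
      rw [mul_assoc, ← smul_eq_C_mul]
      exact V.smul_mem _ (hrow i q hq)
    rw [p.as_sum]
    refine V.sum_mem fun s hs => ?_
    have hs' : s.sum (fun _ e => e) ≤ m + 1 := (le_totalDegree hs).trans hp
    by_cases h0 : s = 0
    · subst h0
      exact hmono _ (by simp)
    · obtain ⟨k, hk⟩ := Finsupp.ne_iff.1 h0
      have h2 : s = (s - Finsupp.single k 1) + Finsupp.single k 1 := by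
        ext l
        by_cases hl : l = k
        · subst hl; simp at hk; simp; omega
        · simp [Finsupp.single_eq_of_ne hl]
      rw [h2, Finsupp.sum_add_index' (fun _ => rfl) (fun _ _ _ => rfl)] at hs'
      simp only [Finsupp.sum_single_index] at hs'
      have : monomial s (coeff s p) = X k * monomial (s - Finsupp.single k 1) (coeff s p) := by
        generalize coeff s p = a
        conv_lhs => rw [h2]
        rw [X, monomial_mul, one_mul, add_comm]
      rw [this]
      exact hX k _ ((totalDegree_monomial_le _ _).trans (Nat.le_of_succ_le_succ hs'))

end HermiteAlgebra

/-! ### Block-orthogonal expansions in a Hilbert space -/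

section GradedHilbert

variable {H J : Type*} [NormedAddCommGroup H] [InnerProductSpace ℝ H]

/-- Orthogonality leaves only the block of degree `d j`, which is already complete once `m ≥ d j`;
the value no longer depends on `m`. -/
lemma inner_graded_partialSum {d : J → ℕ} {F : ℕ → Finset J}
    (hF : ∀ l j, j ∈ F l ↔ d j = l) {ψ : J → H}
    (hψ : ∀ j k, d j ≠ d k → inner ℝ (ψ j) (ψ k) = 0) (C : J → ℝ) {m : ℕ} {j : J}
    (hj : d j ≤ m) :
    inner ℝ (∑ l ∈ Finset.range (m + 1), ∑ k ∈ F l, C k • ψ k) (ψ j) =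
      ∑ k ∈ F (d j), C k * inner ℝ (ψ j) (ψ k) := by
  rw [sum_inner, Finset.sum_eq_single_of_mem (d j) (by simp; omega)]
  · rw [sum_inner]
    refine Finset.sum_congr rfl fun k _ => ?_
    rw [real_inner_smul_left, real_inner_comm]
  · intro l _ hl
    rw [sum_inner]
    refine Finset.sum_eq_zero fun k hk => ?_
    rw [real_inner_smul_left, hψ k j (by rw [(hF l k).1 hk]; exact hl), mul_zero]

/-- Expansion of a vector along a family that is orthogonal across degrees and whose span is
dense: the coefficients solve the Gram systems, degree by degree, iff the expansion converges. -/
theorem gram_system_iff_tendsto {d : J → ℕ} {F : ℕ → Finset J}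
    (hF : ∀ l j, j ∈ F l ↔ d j = l) {ψ : J → H}
    (hψ : ∀ j k, d j ≠ d k → inner ℝ (ψ j) (ψ k) = 0)
    (hdense : Dense (Submodule.span ℝ (Set.range ψ) : Set H)) (Y : H) (C : J → ℝ) :
    (∀ j, ∑ k ∈ F (d j), C k * inner ℝ (ψ j) (ψ k) = inner ℝ Y (ψ j)) ↔
      Tendsto (fun m => ∑ l ∈ Finset.range (m + 1), ∑ k ∈ F l, C k • ψ k) atTop (𝓝 Y) := by
  constructor
  · intro hC
    rw [Metric.tendsto_atTop]
    intro ε hε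
    obtain ⟨v, hv, hYv⟩ := hdense.exists_dist_lt Y hε
    -- The approximant `v` is a finite combination, so its degrees are bounded.
    obtain ⟨M, hM⟩ : ∃ M, v ∈ Submodule.span ℝ (ψ '' {j | d j ≤ M}) := by
      refine Submodule.span_induction ?_ ⟨0, Submodule.zero_mem _⟩ ?_ ?_ hv
      · rintro _ ⟨j, rfl⟩
        exact ⟨d j, Submodule.subset_span ⟨j, le_refl (d j), rfl⟩⟩
      · rintro x y _ _ ⟨M, hx⟩ ⟨M', hy⟩
        refine ⟨max M M', Submodule.add_mem _ (Submodule.span_mono (Set.image_mono ?_) hx)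
          (Submodule.span_mono (Set.image_mono ?_) hy)⟩
        · exact fun j (hj : d j ≤ M) => hj.trans (le_max_left _ _)
        · exact fun j (hj : d j ≤ M') => hj.trans (le_max_right _ _)
      · rintro a x _ ⟨M, hx⟩
        exact ⟨M, Submodule.smul_mem _ a hx⟩
    refine ⟨M, fun m hm => lt_of_le_of_lt ?_ hYv⟩
    set s := ∑ l ∈ Finset.range (m + 1), ∑ k ∈ F l, C k • ψ k with hs
    set V := Submodule.span ℝ (ψ '' {j | d j ≤ m}) with hV
    have hsV : s ∈ V := by
      refine V.sum_mem fun l hl => V.sum_mem fun k hk => V.smul_mem _ (Submodule.subset_span ?_)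
      refine ⟨k, ?_, rfl⟩
      rw [Set.mem_ofPred_eq, (hF l k).1 hk]
      exact Nat.le_of_lt_succ (Finset.mem_range.1 hl)
    have hvV : v ∈ V := Submodule.span_mono
      (Set.image_mono fun j (hj : d j ≤ M) => hj.trans hm) hM
    have horth : ∀ w ∈ V, inner ℝ (Y - s) w = 0 := by
      intro w hw
      refine Submodule.span_induction ?_ (by simp) ?_ ?_ hw
      · rintro _ ⟨j, hj, rfl⟩
        rw [inner_sub_left, inner_graded_partialSum hF hψ C hj, hC, sub_self]
      · intro x y _ _ hx hy
        rw [inner_add_right, hx, hy, add_zero]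
      · intro a x _ hx
        rw [real_inner_smul_right, hx, mul_zero]
    rw [dist_comm, dist_eq_norm, dist_eq_norm]
    -- By Pythagoras, `s` is at least as close to `Y` as any `v` in `V`.
    have hpyth := norm_add_sq_eq_norm_sq_add_norm_sq_real (horth _ (V.sub_mem hsV hvV))
    rw [sub_add_sub_cancel] at hpyth
    nlinarith [norm_nonneg (Y - s), norm_nonneg (Y - v), norm_nonneg (s - v)]
  · intro hlim j
    have h1 := hlim.inner (tendsto_const_nhds (x := ψ j)) (𝕜 := ℝ)
    refine tendsto_nhds_unique (tendsto_const_nhds.congr' ?_) h1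
    filter_upwards [eventually_ge_atTop (d j)] with m hm
    exact (inner_graded_partialSum hF hψ C hm).symm

/-- The Gram systems are solvable. -/
theorem exists_gram_solution {d : J → ℕ} {F : ℕ → Finset J}
    (hF : ∀ l j, j ∈ F l ↔ d j = l) (ψ : J → H) (Y : H) :
    ∃ C : J → ℝ, ∀ j, ∑ k ∈ F (d j), C k * inner ℝ (ψ j) (ψ k) = inner ℝ Y (ψ j) := by
  classical
  have hlevel : ∀ l, ∃ c : J → ℝ, ∀ j ∈ F l,
      ∑ k ∈ F l, c k * inner ℝ (ψ j) (ψ k) = inner ℝ Y (ψ j) := by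
    intro l
    -- Coordinates of the projection onto `W` solve the block of degree `l`, even if its Gram matrix
    -- is singular.
    set W := Submodule.span ℝ (((F l).image ψ : Finset H) : Set H) with hW
    have : FiniteDimensional ℝ W := FiniteDimensional.span_finset ℝ _
    have hmem : W.starProjection Y ∈ Submodule.span ℝ (ψ '' (F l : Set J)) := by
      rw [← Finset.coe_image]; exact W.starProjection_apply_mem Y
    obtain ⟨c, hc⟩ := (Submodule.mem_span_image_finset_iff_exists_fun ℝ).1 hmem
    have hc' : ∑ k ∈ F l, (if h : k ∈ F l then c ⟨k, h⟩ else 0) • ψ k = W.starProjection Y := by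
      rw [← hc, ← Finset.sum_coe_sort]
      simp
    refine ⟨fun k => if h : k ∈ F l then c ⟨k, h⟩ else 0, fun j hj => ?_⟩
    have hjW : ψ j ∈ W := Submodule.subset_span (by
      rw [Finset.coe_image]; exact ⟨j, hj, rfl⟩)
    have h := W.starProjection_inner_eq_zero Y (ψ j) hjW
    rw [inner_sub_left, sub_eq_zero, ← hc', sum_inner] at h
    rw [h]
    exact Finset.sum_congr rfl fun k _ => by rw [real_inner_smul_left, real_inner_comm]
  choose c hc using hlevel
  -- The blocks share no unknowns, so their solutions can be glued.
  refine ⟨fun j => c (d j) j, fun j => ?_⟩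
  rw [← hc (d j) j ((hF _ _).2 rfl)]
  exact Finset.sum_congr rfl fun k hk => by simp only [(hF _ _).1 hk]

end GradedHilbert

/-! ### The density of the Gaussian law -/

section GaussianDensity

open scoped MatrixOrder

variable {N : ℕ}

lemma isSymm_inv_of_posDef {S : Matrix (Fin N) (Fin N) ℝ} (hS : S.PosDef) : S⁻¹.IsSymm := by
  have := hS.inv.isHermitian
  rwa [Matrix.IsHermitian, Matrix.conjTranspose_eq_transpose_of_trivial] at this

lemma gaussianDensity_pos {S : Matrix (Fin N) (Fin N) ℝ} (hS : S.PosDef)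
    (x : EuclideanSpace ℝ (Fin N)) : 0 < gaussianDensity S x := by
  have := hS.det_pos
  unfold gaussianDensity
  positivity

lemma continuous_gaussianDensity (S : Matrix (Fin N) (Fin N) ℝ) :
    Continuous (gaussianDensity S) := by
  unfold gaussianDensity
  fun_prop

lemma gaussianDensity_one (x : EuclideanSpace ℝ (Fin N)) :
    gaussianDensity 1 x = (2 * Real.pi) ^ (-(N : ℝ) / 2) * Real.exp (-(1 / 2) * ‖x‖ ^ 2) := by
  rw [gaussianDensity, EuclideanSpace.real_norm_sq_eq]
  simp [dotProduct, pow_two]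

lemma integrable_gaussianDensity_one :
    Integrable (gaussianDensity (1 : Matrix (Fin N) (Fin N) ℝ)) := by
  have h := (GaussianFourier.integrable_cexp_neg_mul_sq_norm_add (V := EuclideanSpace ℝ (Fin N))
    (b := (1 / 2 : ℂ)) (by norm_num) 0 0).norm
  refine (h.const_mul ((2 * Real.pi) ^ (-(N : ℝ) / 2))).congr (.of_forall fun x => ?_)
  rw [gaussianDensity_one]
  simp only [Complex.norm_exp]
  congr 2
  simp [← Complex.ofReal_pow]

/-- Both measures are finite, so comparing characteristic functions suffices; the Gaussian Fourier
integral computes that of the density. -/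
theorem stdGaussian_eq_withDensity :
    stdGaussian (EuclideanSpace ℝ (Fin N)) =
      volume.withDensity (fun x => ENNReal.ofReal (gaussianDensity 1 x)) := by
  have hpos : ∀ x : EuclideanSpace ℝ (Fin N), 0 < gaussianDensity 1 x :=
    gaussianDensity_pos Matrix.PosDef.one
  have : IsFiniteMeasure (volume.withDensity
      (fun x : EuclideanSpace ℝ (Fin N) => ENNReal.ofReal (gaussianDensity 1 x))) :=
    isFiniteMeasure_withDensity_ofReal integrable_gaussianDensity_one.2
  refine Measure.ext_of_charFun ?_
  ext t
  rw [charFun_stdGaussian, charFun_apply, integral_withDensity_eq_integral_toReal_smul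
    (continuous_gaussianDensity 1).measurable.ennreal_ofReal (by simp)]
  have h := GaussianFourier.integral_cexp_neg_mul_sq_norm_add (V := EuclideanSpace ℝ (Fin N))
    (b := (1 / 2 : ℂ)) (by norm_num) Complex.I t
  have hc : ((2 * Real.pi : ℝ) : ℂ) ^ (((-(N : ℝ) / 2 : ℝ) : ℂ)) *
      ((Real.pi : ℂ) / (1 / 2)) ^ (N / 2 : ℂ) = 1 := by
    have h2 : (Real.pi : ℂ) / (1 / 2) = ((2 * Real.pi : ℝ) : ℂ) := by push_cast; ring
    have h3 : (N / 2 : ℂ) = ((N / 2 : ℝ) : ℂ) := by push_cast; ring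
    have h0 : (0 : ℝ) < 2 * Real.pi := by positivity
    rw [h2, h3, ← Complex.ofReal_cpow h0.le, ← Complex.ofReal_cpow h0.le, ← Complex.ofReal_mul,
      ← Real.rpow_add h0]
    simp [neg_div]
  calc Complex.exp (-‖t‖ ^ 2 / 2)
      = ((2 * Real.pi : ℝ) : ℂ) ^ (((-(N : ℝ) / 2 : ℝ) : ℂ)) *
        ∫ v : EuclideanSpace ℝ (Fin N),
          Complex.exp (-(1 / 2 : ℂ) * ‖v‖ ^ 2 + Complex.I * (inner ℝ t v : ℝ)) := by
        rw [h, finrank_euclideanSpace_fin, ← mul_assoc, hc, one_mul]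
        congr 1
        rw [Complex.I_sq]; ring
    _ = _ := by
        rw [← integral_const_mul]
        refine integral_congr_ae (.of_forall fun v => ?_)
        beta_reduce
        rw [ENNReal.toReal_ofReal (hpos v).le, gaussianDensity_one]
        rw [← Complex.ofReal_cpow (by positivity), Complex.exp_add, ← mul_assoc,
          Complex.real_smul, real_inner_comm, mul_comm Complex.I]
        push_cast
        rfl

/-- A centered multivariate Gaussian with positive definite covariance matrix has the Gaussian
density. -/
theorem multivariateGaussian_eq_withDensity {S : Matrix (Fin N) (Fin N) ℝ} (hS : S.PosDef) :
    multivariateGaussian 0 S =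
      volume.withDensity (fun x => ENNReal.ofReal (gaussianDensity S x)) := by
  -- The law is the image of the standard Gaussian under `R = √S`, so its density comes from the
  -- change of variables `x = R u`.
  set R := CFC.sqrt S with hR
  have hRR : R * R = S := CFC.sqrt_mul_sqrt_self S hS.posSemidef.nonneg
  have hRsymm : R.transpose = R := by
    have := (CFC.sqrt_nonneg S).isSelfAdjoint.star_eq
    rwa [Matrix.star_eq_conjTranspose, Matrix.conjTranspose_eq_transpose_of_trivial] at this
  have hdet : R.det * R.det = S.det := by rw [← Matrix.det_mul, hRR]
  have hRdet : 0 < R.det := by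
    have h0 : 0 ≤ R.det := (Matrix.nonneg_iff_posSemidef.1 (CFC.sqrt_nonneg S)).det_nonneg
    refine h0.lt_of_ne fun h => hS.det_pos.ne ?_
    rw [← hdet, ← h, zero_mul]
  set T : EuclideanSpace ℝ (Fin N) →L[ℝ] EuclideanSpace ℝ (Fin N) :=
    Matrix.toEuclideanCLM (𝕜 := ℝ) R with hT
  have hTdet : LinearMap.det (T : EuclideanSpace ℝ (Fin N) →ₗ[ℝ] EuclideanSpace ℝ (Fin N))
      = R.det := by
    rw [hT, Matrix.coe_toEuclideanCLM_eq_toEuclideanLin, Matrix.toEuclideanLin,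
      Matrix.toLpLin_eq_toLin,
      LinearMap.det_toLin]
  -- Here `(R u)ᵀ S⁻¹ (R u) = ‖u‖²`, and the Jacobian `det R` cancels the factor `(det S)^(-1/2)`.
  have hquad : ∀ u : EuclideanSpace ℝ (Fin N),
      gaussianDensity 1 u = R.det * gaussianDensity S (T u) := by
    intro u
    have h1 : (fun i => (T u) i) = R *ᵥ (fun i => u i) := rfl
    have h2 : R * (S⁻¹ * R) = 1 := by
      have hu : IsUnit R.det := hRdet.ne'.isUnit
      rw [← hRR, Matrix.mul_inv_rev, Matrix.mul_assoc R⁻¹, Matrix.nonsing_inv_mul _ hu,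
        Matrix.mul_one, Matrix.mul_nonsing_inv _ hu]
    have h3 : (R *ᵥ (fun i => u i)) ⬝ᵥ (S⁻¹ *ᵥ (R *ᵥ (fun i => u i))) = ‖u‖ ^ 2 := by
      rw [Matrix.mulVec_mulVec, ← Matrix.vecMul_transpose, hRsymm, ← Matrix.dotProduct_mulVec,
        Matrix.mulVec_mulVec, h2, Matrix.one_mulVec, EuclideanSpace.real_norm_sq_eq]
      simp [dotProduct, pow_two]
    have h4 : R.det * S.det ^ (-(1 / 2) : ℝ) = 1 := by
      rw [← hdet, ← pow_two, ← Real.rpow_natCast, ← Real.rpow_mul hRdet.le]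
      norm_num
      rw [Real.rpow_neg_one, mul_inv_cancel₀ hRdet.ne']
    rw [gaussianDensity_one, gaussianDensity, h1, h3]
    linear_combination (-((2 * Real.pi) ^ (-(N : ℝ) / 2) * Real.exp (-(1 / 2) * ‖u‖ ^ 2))) * h4
  have hmap := Measure.map_linearMap_addHaar_eq_smul_addHaar
    (volume : Measure (EuclideanSpace ℝ (Fin N)))
    (f := (T : EuclideanSpace ℝ (Fin N) →ₗ[ℝ] EuclideanSpace ℝ (Fin N)))
    (by rw [hTdet]; exact hRdet.ne')
  rw [hTdet] at hmap
  have hTm : Measurable T := T.continuous.measurable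
  ext s hs
  have h0 : multivariateGaussian 0 S = (stdGaussian (EuclideanSpace ℝ (Fin N))).map T := by
    simp [multivariateGaussian, hT, hR]
  rw [h0, Measure.map_apply hTm hs, stdGaussian_eq_withDensity,
    withDensity_apply _ (hTm hs), withDensity_apply _ hs]
  have h5 : ∫⁻ u in T ⁻¹' s, ENNReal.ofReal (gaussianDensity 1 u) =
      ENNReal.ofReal R.det * ∫⁻ u in T ⁻¹' s, ENNReal.ofReal (gaussianDensity S (T u)) := by
    rw [← lintegral_const_mul (f := fun u => ENNReal.ofReal (gaussianDensity S (T u))) _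
      ((continuous_gaussianDensity S).measurable.comp hTm).ennreal_ofReal]
    simp_rw [hquad, ENNReal.ofReal_mul hRdet.le]
  have h6 := setLIntegral_map (μ := volume) hs
    (continuous_gaussianDensity S).measurable.ennreal_ofReal hTm
  have hmap' : Measure.map T volume = ENNReal.ofReal |R.det⁻¹| • volume := hmap
  rw [h5, ← h6, hmap', Measure.restrict_smul, lintegral_smul_measure, smul_eq_mul, ← mul_assoc,
    ← ENNReal.ofReal_mul hRdet.le, abs_of_pos (inv_pos.2 hRdet), mul_inv_cancel₀ hRdet.ne',
    ENNReal.ofReal_one, one_mul]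

lemma integral_multivariateGaussian {S : Matrix (Fin N) (Fin N) ℝ} (hS : S.PosDef)
    (f : EuclideanSpace ℝ (Fin N) → ℝ) :
    ∫ x, f x ∂(multivariateGaussian 0 S) = ∫ x, f x * gaussianDensity S x := by
  rw [multivariateGaussian_eq_withDensity hS, integral_withDensity_eq_integral_toReal_smul
    (continuous_gaussianDensity S).measurable.ennreal_ofReal (by simp)]
  refine integral_congr_ae (.of_forall fun x => ?_)
  simp [ENNReal.toReal_ofReal (gaussianDensity_pos hS x).le, mul_comm]

lemma integrable_multivariateGaussian_iff {S : Matrix (Fin N) (Fin N) ℝ} (hS : S.PosDef)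
    {f : EuclideanSpace ℝ (Fin N) → ℝ} :
    Integrable f (multivariateGaussian 0 S) ↔ Integrable (fun x => f x * gaussianDensity S x) := by
  rw [multivariateGaussian_eq_withDensity hS, integrable_withDensity_iff
    (continuous_gaussianDensity S).measurable.ennreal_ofReal (by simp)]
  simp only [ENNReal.toReal_ofReal (gaussianDensity_pos hS _).le]

end GaussianDensity

/-! ### Calculus and integrals of polynomials against the Gaussian -/

section GaussianPolynomials

open MvPolynomial

variable {N : ℕ}

lemma hasFDerivAt_mvPolynomial_eval (p : MvPolynomial (Fin N) ℝ) (x : EuclideanSpace ℝ (Fin N)) :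
    HasFDerivAt (fun x : EuclideanSpace ℝ (Fin N) => eval (fun i => x i) p)
      (∑ i, eval (fun i => x i) (pderiv i p) •
        (EuclideanSpace.proj i : EuclideanSpace ℝ (Fin N) →L[ℝ] ℝ)) x := by
  induction p using MvPolynomial.induction_on with
  | C a => simpa using hasFDerivAt_const a x
  | add p q hp hq =>
    simp only [map_add, add_smul, Finset.sum_add_distrib]
    exact hp.fun_add hq
  | mul_X p k hp =>
    have hX : HasFDerivAt (fun x : EuclideanSpace ℝ (Fin N) => x k)
        (EuclideanSpace.proj k : EuclideanSpace ℝ (Fin N) →L[ℝ] ℝ) x :=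
      (EuclideanSpace.proj k : EuclideanSpace ℝ (Fin N) →L[ℝ] ℝ).hasFDerivAt
    simp only [map_mul, eval_X]
    refine (hp.fun_mul hX).congr_fderiv ?_
    simp only [pderiv_mul, map_add, map_mul, eval_X, add_smul, Finset.sum_add_distrib, pderiv_X,
      Finset.smul_sum, smul_smul]
    rw [add_comm]
    congr 1
    · exact Finset.sum_congr rfl fun i _ => by rw [mul_comm]
    · rw [Finset.sum_eq_single k]
      · simp
      · intro i _ hi
        simp [Pi.single_eq_of_ne' hi]
      · simp

lemma hasFDerivAt_gaussianDensity {S : Matrix (Fin N) (Fin N) ℝ} (hS : S⁻¹.IsSymm)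
    (x : EuclideanSpace ℝ (Fin N)) :
    HasFDerivAt (gaussianDensity S)
      (∑ i, (-(eval (fun i => x i) (rowForm S⁻¹ i) * gaussianDensity S x)) •
        (EuclideanSpace.proj i : EuclideanSpace ℝ (Fin N) →L[ℝ] ℝ)) x := by
  set q : MvPolynomial (Fin N) ℝ := ∑ i, X i * rowForm S⁻¹ i with hq
  have hqe : ∀ x : EuclideanSpace ℝ (Fin N),
      (fun i => x i) ⬝ᵥ (S⁻¹ *ᵥ (fun i => x i)) = eval (fun i => x i) q := fun x => by
    simp [hq, rowForm, dotProduct, Matrix.mulVec]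
  have hqd : ∀ i, pderiv i q = 2 * rowForm S⁻¹ i := by
    intro i
    simp only [hq, map_sum, pderiv_mul, pderiv_rowForm, pderiv_X, Finset.sum_add_distrib]
    have h1 : ∑ k, (Pi.single i 1 : Fin N → MvPolynomial (Fin N) ℝ) k * rowForm S⁻¹ k =
        rowForm S⁻¹ i := by simp [Pi.single_apply]
    have h2 : ∑ k, (X k : MvPolynomial (Fin N) ℝ) * C (S⁻¹ k i) = rowForm S⁻¹ i := by
      rw [rowForm]
      exact Finset.sum_congr rfl fun k _ => by rw [hS.apply, mul_comm]
    rw [h1, h2]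
    ring
  have h := (((hasFDerivAt_mvPolynomial_eval q x).const_mul (-(1 / 2))).exp).const_mul
    ((2 * Real.pi) ^ (-(N : ℝ) / 2) * S.det ^ (-(1 / 2) : ℝ))
  have hfun : gaussianDensity S = fun x : EuclideanSpace ℝ (Fin N) =>
      (2 * Real.pi) ^ (-(N : ℝ) / 2) * S.det ^ (-(1 / 2) : ℝ) *
        Real.exp (-(1 / 2) * eval (fun i => x i) q) := by
    ext x; rw [gaussianDensity, hqe]
  rw [hfun]
  refine h.congr_fderiv (Eq.symm ?_)
  rw [Finset.smul_sum, Finset.smul_sum, Finset.smul_sum]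
  refine Finset.sum_congr rfl fun i _ => ?_
  rw [smul_smul, smul_smul, smul_smul, hqd]
  congr 1
  simp
  ring

lemma proj_sum_single (c : Fin N → ℝ) (i : Fin N) :
    (∑ k, c k • (EuclideanSpace.proj k : EuclideanSpace ℝ (Fin N) →L[ℝ] ℝ))
      (EuclideanSpace.single i 1) = c i := by
  simp [sum_apply]

lemma fderiv_mvPolynomial_eval (p : MvPolynomial (Fin N) ℝ) (x : EuclideanSpace ℝ (Fin N))
    (i : Fin N) :
    fderiv ℝ (fun x : EuclideanSpace ℝ (Fin N) => eval (fun i => x i) p) x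
      (EuclideanSpace.single i 1) = eval (fun i => x i) (pderiv i p) := by
  rw [(hasFDerivAt_mvPolynomial_eval p x).fderiv, proj_sum_single]

lemma differentiable_mul_gaussianDensity {S : Matrix (Fin N) (Fin N) ℝ} (hS : S⁻¹.IsSymm)
    (p : MvPolynomial (Fin N) ℝ) (x : EuclideanSpace ℝ (Fin N)) :
    DifferentiableAt ℝ
      (fun x : EuclideanSpace ℝ (Fin N) => eval (fun i => x i) p * gaussianDensity S x) x :=
  (hasFDerivAt_mvPolynomial_eval p x).differentiableAt.mul
    (hasFDerivAt_gaussianDensity hS x).differentiableAt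

lemma fderiv_mul_gaussianDensity {S : Matrix (Fin N) (Fin N) ℝ} (hS : S⁻¹.IsSymm)
    (p : MvPolynomial (Fin N) ℝ) (x : EuclideanSpace ℝ (Fin N)) (i : Fin N) :
    fderiv ℝ (fun x : EuclideanSpace ℝ (Fin N) => eval (fun i => x i) p * gaussianDensity S x) x
      (EuclideanSpace.single i 1) =
      eval (fun i => x i) (hermiteOp S⁻¹ i p) * gaussianDensity S x := by
  have h := (hasFDerivAt_mvPolynomial_eval p x).mul (hasFDerivAt_gaussianDensity hS x)
  have h' : fderiv ℝ
      (fun x : EuclideanSpace ℝ (Fin N) => eval (fun i => x i) p * gaussianDensity S x) x = _ :=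
    h.fderiv
  rw [h', add_apply, smul_apply,
    smul_apply, proj_sum_single, proj_sum_single, hermiteOp_apply]
  simp
  ring

/-- Functions of the form polynomial times density are stable under each `∂_i`, which acts on the
polynomial factor as `hermiteOp`. -/
lemma multiDerivative_gaussianDensity {S : Matrix (Fin N) (Fin N) ℝ} (hS : S⁻¹.IsSymm)
    (j : Fin N → ℕ) :
    multiDerivative j (gaussianDensity S) = fun x : EuclideanSpace ℝ (Fin N) =>
      eval (fun i => x i) (hermitePoly S⁻¹ j) * gaussianDensity S x := by
  have hstep : ∀ (i : Fin N) (p : MvPolynomial (Fin N) ℝ),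
      partialDerivative i (fun x : EuclideanSpace ℝ (Fin N) =>
        eval (fun i => x i) p * gaussianDensity S x) =
      fun x => eval (fun i => x i) (hermiteOp S⁻¹ i p) * gaussianDensity S x := fun i p => by
    ext x
    rw [partialDerivative, (differentiable_mul_gaussianDensity hS p x).lineDeriv_eq_fderiv,
      fderiv_mul_gaussianDensity hS]
  have hiter : ∀ (i : Fin N) (n : ℕ) (p : MvPolynomial (Fin N) ℝ),
      (partialDerivative i)^[n] (fun x : EuclideanSpace ℝ (Fin N) =>
        eval (fun i => x i) p * gaussianDensity S x) =
      fun x => eval (fun i => x i) ((hermiteOp S⁻¹ i)^[n] p) * gaussianDensity S x := by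
    intro i n
    induction n with
    | zero => exact fun p => rfl
    | succ n ih => exact fun p => by rw [Function.iterate_succ_apply, hstep, ih]; rfl
  unfold multiDerivative hermitePoly
  induction List.finRange N with
  | nil => simp
  | cons i L ih => rw [List.foldr_cons, ih, hiter]; rfl

lemma hermiteH_eq_eval {S : Matrix (Fin N) (Fin N) ℝ} (hS : S.PosDef) (j : Fin N → ℕ)
    (x : EuclideanSpace ℝ (Fin N)) :
    hermiteH S j x = (-1) ^ (∑ i, j i) * eval (fun i => x i) (hermitePoly S⁻¹ j) := by
  have hsymm := isSymm_inv_of_posDef hS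
  have := (gaussianDensity_pos hS x).ne'
  rw [hermiteH, multiDerivative_gaussianDensity hsymm]
  field_simp

lemma memLp_mvPolynomial_eval (μ : Measure (EuclideanSpace ℝ (Fin N))) [IsGaussian μ]
    (p : MvPolynomial (Fin N) ℝ) (r : ENNReal) (hr : r ≠ ⊤) :
    MemLp (fun x : EuclideanSpace ℝ (Fin N) => eval (fun i => x i) p) r μ := by
  induction p using MvPolynomial.induction_on generalizing r with
  | C a => simpa using memLp_const a
  | add p q hp hq => simpa using! (hp r hr).add (hq r hr)
  | mul_X p k hp =>
    have h2 : 2 * r ≠ ⊤ := ENNReal.mul_ne_top (by simp) hr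
    have hX := IsGaussian.memLp_dual μ (EuclideanSpace.proj k) (2 * r) h2
    -- Hölder's inequality doubles the exponent at each factor, hence the induction over all finite
    -- `r` at once.
    have : ENNReal.HolderTriple (2 * r) (2 * r) r := by
      constructor
      rw [ENNReal.mul_inv (by simp) (by simp), ← two_mul, ← mul_assoc,
        ENNReal.mul_inv_cancel (by simp) (by simp), one_mul]
    simpa using! hX.mul (hp (2 * r) h2) (r := r)

lemma integrable_mvPolynomial_eval (μ : Measure (EuclideanSpace ℝ (Fin N))) [IsGaussian μ]
    (p : MvPolynomial (Fin N) ℝ) :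
    Integrable (fun x : EuclideanSpace ℝ (Fin N) => eval (fun i => x i) p) μ :=
  memLp_one_iff_integrable.1 (memLp_mvPolynomial_eval μ p 1 (by simp))

/-- Gaussian integration by parts for polynomials. -/
lemma integral_mul_hermiteOp {S : Matrix (Fin N) (Fin N) ℝ} (hS : S.PosDef) (i : Fin N)
    (p q : MvPolynomial (Fin N) ℝ) :
    ∫ x, eval (fun i => x i) (q * hermiteOp S⁻¹ i p) ∂(multivariateGaussian 0 S) =
      - ∫ x, eval (fun i => x i) (pderiv i q * p) ∂(multivariateGaussian 0 S) := by
  have hsymm := isSymm_inv_of_posDef hS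
  have hint : ∀ p q : MvPolynomial (Fin N) ℝ, Integrable (fun x : EuclideanSpace ℝ (Fin N) =>
      eval (fun i => x i) p * (eval (fun i => x i) q * gaussianDensity S x)) := by
    intro p q
    have := (integrable_multivariateGaussian_iff hS).1
      (integrable_mvPolynomial_eval (multivariateGaussian 0 S) (p * q))
    simpa [mul_assoc] using this
  have h := integral_mul_fderiv_eq_neg_fderiv_mul_of_integrable (𝕜 := ℝ)
    (μ := (volume : Measure (EuclideanSpace ℝ (Fin N))))
    (f := fun x : EuclideanSpace ℝ (Fin N) => eval (fun i => x i) q)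
    (g := fun x : EuclideanSpace ℝ (Fin N) => eval (fun i => x i) p * gaussianDensity S x)
    (v := EuclideanSpace.single i 1)
    (by simpa only [fderiv_mvPolynomial_eval] using hint _ _)
    (by simpa only [fderiv_mul_gaussianDensity hsymm] using hint _ _)
    (hint _ _)
    (fun x _ => (hasFDerivAt_mvPolynomial_eval q x).differentiableAt)
    (fun x _ => differentiable_mul_gaussianDensity hsymm p x)
  simp only [fderiv_mvPolynomial_eval, fderiv_mul_gaussianDensity hsymm] at h
  rw [integral_multivariateGaussian hS, integral_multivariateGaussian hS]
  simpa only [map_mul, mul_assoc] using h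

/-- The Hermite polynomials are orthogonal to all polynomials of lower degree. -/
lemma integral_mul_hermitePoly_eq_zero {S : Matrix (Fin N) (Fin N) ℝ} (hS : S.PosDef)
    (j : Fin N → ℕ) (q : MvPolynomial (Fin N) ℝ) (hq : q.totalDegree < ∑ i, j i) :
    ∫ x, eval (fun i => x i) (q * hermitePoly S⁻¹ j) ∂(multivariateGaussian 0 S) = 0 := by
  have hsymm := isSymm_inv_of_posDef hS
  set μ := multivariateGaussian 0 S
  let I : MvPolynomial (Fin N) ℝ →ₗ[ℝ] ℝ :=
    { toFun := fun p => ∫ x, eval (fun i => x i) p ∂μ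
      map_add' := fun p q => by
        simp only [map_add]
        exact integral_add (integrable_mvPolynomial_eval μ p) (integrable_mvPolynomial_eval μ q)
      map_smul' := fun a p => by
        simp only [smul_eval, RingHom.id_apply, smul_eq_mul]
        exact integral_const_mul _ _ }
  exact hermitePoly_orthogonal hsymm ((LinearMap.mul ℝ (MvPolynomial (Fin N) ℝ)).compr₂ I)
    (fun i p q => integral_mul_hermiteOp hS i p q) j q hq

end GaussianPolynomials

/-! ### Density of polynomials through the Fourier transform -/

section PolynomialDensity

variable {E : Type*} [NormedAddCommGroup E] [InnerProductSpace ℝ E]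
  [MeasurableSpace E] [BorelSpace E]

/-- The law of `L` is a real Gaussian, which has all exponential moments, and `exp(2|t|) ≤ exp(2t) +
exp(-2t)`. This supplies the dominating function for the exponential series. -/
lemma memLp_exp_abs_dual {μ : Measure E} [IsGaussian μ] (L : StrongDual ℝ E) :
    MemLp (fun x => Real.exp |L x|) 2 μ := by
  have hc : Continuous fun x => Real.exp |L x| := by fun_prop
  rw [memLp_two_iff_integrable_sq hc.aestronglyMeasurable]
  have hexp : ∀ c : ℝ, Integrable (fun x => Real.exp (c * L x)) μ := by
    intro c
    have h := integrable_exp_mul_gaussianReal (μ := ∫ x, L x ∂μ) (v := Var[L; μ].toNNReal) c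
    rw [← IsGaussian.map_eq_gaussianReal L, integrable_map_measure
      (Continuous.aestronglyMeasurable (by fun_prop)) L.continuous.aemeasurable] at h
    exact h
  refine ((hexp 2).add (hexp (-2))).mono' (hc.pow 2).aestronglyMeasurable (.of_forall fun x => ?_)
  rw [← Real.exp_nat_mul, Real.norm_eq_abs, abs_of_pos (Real.exp_pos _)]
  simp only [Pi.add_apply]
  rcases abs_choice (L x) with h | h <;> rw [h]
  · have := Real.exp_pos (-2 * L x); simpa using this.le
  · have := Real.exp_pos (2 * L x); simpa using this.le

variable [FiniteDimensional ℝ E]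

/-- A function is determined, almost everywhere, by the Fourier transform of its product with
a finite measure. -/
theorem ae_eq_zero_of_integral_mul_cexp_eq_zero {μ : Measure E} [IsFiniteMeasure μ] {f : E → ℝ}
    (hf : Integrable f μ)
    (h : ∀ t, ∫ x, (f x : ℂ) * Complex.exp ((inner ℝ x t : ℝ) * Complex.I) ∂μ = 0) :
    f =ᵐ[μ] 0 := by
  set g := hf.1.mk f with hg
  have hfg : f =ᵐ[μ] g := hf.1.ae_eq_mk
  have hgm : Measurable g := hf.1.stronglyMeasurable_mk.measurable
  have hgm' : Measurable fun x => -g x := hgm.neg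
  have hgi : Integrable g μ := hf.congr hfg
  have hgi' : Integrable (fun x => -g x) μ := hgi.neg
  have hpos : Integrable (fun x => max (g x) 0) μ := hgi.pos_part
  have hneg : Integrable (fun x => max (-g x) 0) μ := hgi.neg_part
  have hf1 : IsFiniteMeasure (μ.withDensity fun x => ENNReal.ofReal (g x)) :=
    isFiniteMeasure_withDensity_ofReal hgi.2
  have hf2 : IsFiniteMeasure (μ.withDensity fun x => ENNReal.ofReal (-g x)) :=
    isFiniteMeasure_withDensity_ofReal hgi'.2
  have hchar : ∀ t : E, ∀ u : E → ℝ, Integrable u μ →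
      Integrable (fun x => (u x : ℂ) * Complex.exp ((inner ℝ x t : ℝ) * Complex.I)) μ := by
    intro t u hu
    refine hu.ofReal.mul_bdd (c := 1) (Continuous.aestronglyMeasurable (by fun_prop))
      (.of_forall fun x => ?_)
    rw [Complex.norm_exp_ofReal_mul_I]
  -- `ENNReal.ofReal` truncates at zero, so these densities are the positive and negative parts of
  -- `g`. The hypothesis says that their characteristic functions agree.
  have heq : (μ.withDensity fun x => ENNReal.ofReal (g x)) =
      μ.withDensity fun x => ENNReal.ofReal (-g x) := by
    refine Measure.ext_of_charFun ?_
    ext t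
    rw [charFun_apply, charFun_apply,
      integral_withDensity_eq_integral_toReal_smul hgm.ennreal_ofReal (by simp),
      integral_withDensity_eq_integral_toReal_smul hgm'.ennreal_ofReal (by simp),
      ← sub_eq_zero]
    simp only [ENNReal.toReal_ofReal', Complex.real_smul]
    rw [← integral_sub (hchar t _ hpos) (hchar t _ hneg), ← h t]
    refine integral_congr_ae ?_
    filter_upwards [hfg] with x hx
    rw [← sub_mul, ← Complex.ofReal_sub, hx]
    congr 2
    exact posPart_sub_negPart (g x)
  have hae := (withDensity_eq_iff hgm.ennreal_ofReal.aemeasurable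
    hgm'.ennreal_ofReal.aemeasurable
    ?_).1 heq
  · filter_upwards [hfg, hae] with x hx hx'
    rw [hx]
    have := congrArg ENNReal.toReal hx'
    simp only [ENNReal.toReal_ofReal'] at this
    rw [Pi.zero_apply]
    rcases le_total 0 (g x) with h0 | h0
    · rw [max_eq_left h0, max_eq_right (by linarith)] at this
      exact this
    · rw [max_eq_right h0, max_eq_left (by linarith)] at this
      linarith
  · exact hgi.lintegral_lt_top.ne

/-- A square integrable function which is orthogonal to all powers of continuous linear forms
for a Gaussian measure vanishes almost everywhere. -/
theorem ae_eq_zero_of_integral_mul_pow_dual_eq_zero {μ : Measure E} [IsGaussian μ] {f : E → ℝ}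
    (hf : MemLp f 2 μ) (h : ∀ (L : StrongDual ℝ E) (n : ℕ), ∫ x, f x * L x ^ n ∂μ = 0) :
    f =ᵐ[μ] 0 := by
  refine ae_eq_zero_of_integral_mul_cexp_eq_zero (hf.integrable one_le_two) fun t => ?_
  set L : StrongDual ℝ E := innerSL ℝ t with hL
  have hLx : ∀ x, inner ℝ x t = L x := fun x => by rw [real_inner_comm]; rfl
  -- Termwise integration of the series of `f exp(iL)`: the bounds sum to `|f| exp|L|`, a product of
  -- two `L²` functions.
  have hsum := hasSum_integral_of_dominated_convergence (μ := μ)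
    (F := fun (n : ℕ) x => (f x : ℂ) * (((L x : ℝ) * Complex.I) ^ n / (n.factorial : ℂ)))
    (f := fun x => (f x : ℂ) * Complex.exp ((L x : ℝ) * Complex.I))
    (fun n x => |f x| * (|L x| ^ n / n.factorial)) ?_ ?_ ?_ ?_ ?_
  · simp_rw [hLx]
    refine hsum.unique ?_
    have hz : ∀ n : ℕ,
        ∫ x, (f x : ℂ) * (((L x : ℝ) * Complex.I) ^ n / (n.factorial : ℂ)) ∂μ = 0 := by
      intro n
      have h1 : ∀ x, (f x : ℂ) * (((L x : ℝ) * Complex.I) ^ n / (n.factorial : ℂ)) =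
          (Complex.I ^ n / n.factorial) * ((f x * L x ^ n : ℝ) : ℂ) := fun x => by
        push_cast; ring
      simp_rw [h1]
      rw [integral_const_mul, integral_complex_ofReal, h L n]
      simp
    simp_rw [hz]
    exact hasSum_zero
  · exact fun n => (Complex.continuous_ofReal.comp_aestronglyMeasurable hf.1).mul
      (Continuous.aestronglyMeasurable (by fun_prop))
  · intro n
    refine .of_forall fun x => ?_
    simp
  · exact .of_forall fun x => (Real.summable_pow_div_factorial _).mul_left _
  · simp_rw [tsum_mul_left]
    have h1 : ∀ x, ∑' n : ℕ, |L x| ^ n / n.factorial = Real.exp |L x| := fun x => by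
      rw [Real.exp_eq_exp_ℝ, NormedSpace.exp_eq_tsum_div]
    simp_rw [h1]
    exact hf.abs.integrable_mul (memLp_exp_abs_dual L)
  · refine .of_forall fun x => HasSum.mul_left _ ?_
    have := NormedSpace.expSeries_div_hasSum_exp ((L x : ℝ) * Complex.I : ℂ)
    rwa [← Complex.exp_eq_exp_ℂ] at this

end PolynomialDensity

/-! ### Totality of the standardized Hermite polynomials in `L²` -/

section HermiteExpansion

variable {N : ℕ}

lemma inner_toLp {α : Type*} [MeasurableSpace α] {μ : Measure α} {f g : α → ℝ}
    (hf : MemLp f 2 μ) (hg : MemLp g 2 μ) :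
    inner ℝ (hf.toLp f) (hg.toLp g) = ∫ x, f x * g x ∂μ := by
  rw [L2.inner_def]
  refine integral_congr_ae ?_
  filter_upwards [hf.coeFn_toLp, hg.coeFn_toLp] with x hx hx'
  rw [hx, hx', real_inner_eq_re_inner, RCLike.inner_apply]
  simp [mul_comm]

lemma toLp_sum {α ι : Type*} [MeasurableSpace α] {μ : Measure α} {f : ι → α → ℝ}
    (hf : ∀ i, MemLp (f i) 2 μ) (s : Finset ι) :
    (memLp_finsetSum s fun i _ => hf i).toLp (fun x => ∑ i ∈ s, f i x) =
      ∑ i ∈ s, (hf i).toLp (f i) := by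
  classical
  induction s using Finset.induction_on with
  | empty => simp; rfl
  | insert i s hi ih =>
    rw [Finset.sum_insert hi, ← ih, ← MemLp.toLp_add]
    congr 1
    ext x
    simp [Finset.sum_insert hi]

lemma mem_multiIndices (l : ℕ) (j : Fin N → ℕ) : j ∈ multiIndices N l ↔ ∑ i, j i = l := by
  simp [multiIndices, Finset.mem_piAntidiag]

/-- The class in `L²` of a polynomial, for a Gaussian measure. -/
noncomputable def polynomialToLp (μ : Measure (EuclideanSpace ℝ (Fin N))) [IsGaussian μ] :
    MvPolynomial (Fin N) ℝ →ₗ[ℝ] Lp ℝ 2 μ where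
  toFun p := (memLp_mvPolynomial_eval μ p 2 (by simp)).toLp _
  map_add' p q := by
    rw [← MemLp.toLp_add]
    congr 1
    ext x
    simp
  map_smul' a p := by
    rw [RingHom.id_apply, ← MemLp.toLp_const_smul]
    congr 1
    ext x
    simp

variable {S : Matrix (Fin N) (Fin N) ℝ}

lemma memLp_hermiteH (hS : S.PosDef) (j : Fin N → ℕ) :
    MemLp (hermiteH S j) 2 (multivariateGaussian 0 S) := by
  have h : hermiteH S j = fun x : EuclideanSpace ℝ (Fin N) =>
      (-1) ^ (∑ i, j i) * MvPolynomial.eval (fun i => x i) (hermitePoly S⁻¹ j) :=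
    funext fun x => hermiteH_eq_eval hS j x
  rw [h]
  exact (memLp_mvPolynomial_eval _ _ 2 (by simp)).const_mul _

lemma memLp_hermitePsi (hS : S.PosDef) (j : Fin N → ℕ) :
    MemLp (hermitePsi S j) 2 (multivariateGaussian 0 S) := by
  unfold hermitePsi
  simp_rw [div_eq_mul_inv]
  exact (memLp_hermiteH hS j).mul_const _

lemma integral_hermitePsi_mul_eq_zero (hS : S.PosDef) {j k : Fin N → ℕ}
    (hjk : ∑ i, j i ≠ ∑ i, k i) :
    ∫ x, hermitePsi S j x * hermitePsi S k x ∂(multivariateGaussian 0 S) = 0 := by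
  wlog h : ∑ i, j i < ∑ i, k i generalizing j k
  · simp_rw [mul_comm (hermitePsi S j _)]
    exact this hjk.symm (hjk.lt_or_gt.resolve_left h)
  have h0 := integral_mul_hermitePoly_eq_zero hS k (hermitePoly S⁻¹ j)
    ((hermitePoly_totalDegree_le (isSymm_inv_of_posDef hS) j).trans_lt h)
  have h1 : ∀ a b : ℝ, ∀ x : EuclideanSpace ℝ (Fin N),
      (-1) ^ (∑ i, j i) * MvPolynomial.eval (fun i => x i) (hermitePoly S⁻¹ j) / a *
        ((-1) ^ (∑ i, k i) * MvPolynomial.eval (fun i => x i) (hermitePoly S⁻¹ k) / b) =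
      ((-1) ^ (∑ i, j i) * (-1) ^ (∑ i, k i) / (a * b)) *
        MvPolynomial.eval (fun i => x i) (hermitePoly S⁻¹ j * hermitePoly S⁻¹ k) := by
    intro a b x
    rw [map_mul]
    ring
  simp_rw [hermitePsi, hermiteH_eq_eval hS, h1]
  rw [integral_const_mul, h0, mul_zero]

/-- Positivity of the normalizing constant is not needed: if it is zero, `H_j` vanishes almost
everywhere, in accordance with `Ψ_j = 0` from division by zero. -/
lemma hermiteH_ae_eq (hS : S.PosDef) (j : Fin N → ℕ) :
    hermiteH S j =ᵐ[multivariateGaussian 0 S]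
      fun x => √(∫ z, hermiteH S j z * hermiteH S j z * gaussianDensity S z) *
        hermitePsi S j x := by
  by_cases h0 : √(∫ z, hermiteH S j z * hermiteH S j z * gaussianDensity S z) = 0
  · have h1 : ∫ z, hermiteH S j z * hermiteH S j z * gaussianDensity S z = 0 :=
      le_antisymm (Real.sqrt_eq_zero'.1 h0) (integral_nonneg fun z =>
        mul_nonneg (mul_self_nonneg _) (gaussianDensity_pos hS z).le)
    rw [← integral_multivariateGaussian hS (fun z => hermiteH S j z * hermiteH S j z),
      integral_eq_zero_iff_of_nonneg (fun z => mul_self_nonneg _)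
        ((memLp_hermiteH hS j).integrable_mul (memLp_hermiteH hS j))] at h1
    filter_upwards [h1] with x hx
    rw [h0, zero_mul]
    exact mul_self_eq_zero.1 hx
  · refine .of_forall fun x => ?_
    exact (mul_div_cancel₀ _ h0).symm

lemma polynomialToLp_mem_span (hS : S.PosDef) (p : MvPolynomial (Fin N) ℝ) :
    polynomialToLp (multivariateGaussian 0 S) p ∈
      Submodule.span ℝ (Set.range fun j => (memLp_hermitePsi hS j).toLp (hermitePsi S j)) := by
  have hu : IsUnit S.det := hS.det_pos.ne'.isUnit
  have hp := Submodule.mem_map_of_mem (f := polynomialToLp (multivariateGaussian 0 S))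
    (mem_span_hermitePoly (isSymm_inv_of_posDef hS) (Matrix.mul_nonsing_inv S hu)
      p.totalDegree p le_rfl)
  rw [Submodule.map_span] at hp
  refine Submodule.span_le.2 ?_ hp
  rintro _ ⟨_, ⟨j, -, rfl⟩, rfl⟩
  have h : polynomialToLp (multivariateGaussian 0 S) (hermitePoly S⁻¹ j) =
      ((-1) ^ (∑ i, j i) * √(∫ z, hermiteH S j z * hermiteH S j z * gaussianDensity S z)) •
        (memLp_hermitePsi hS j).toLp (hermitePsi S j) := by
    rw [← MemLp.toLp_const_smul]
    refine MemLp.toLp_congr (memLp_mvPolynomial_eval _ _ 2 (by simp)) _ ?_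
    filter_upwards [hermiteH_ae_eq hS j] with x hx
    rw [hermiteH_eq_eval hS] at hx
    have hsq : ((-1 : ℝ) ^ (∑ i, j i)) * (-1) ^ (∑ i, j i) = 1 := by
      rw [← mul_pow]; simp
    rw [Pi.smul_apply, smul_eq_mul, mul_assoc, ← hx, ← mul_assoc, hsq, one_mul]
  rw [h]
  exact Submodule.smul_mem _ _ (Submodule.subset_span ⟨j, rfl⟩)

/-- The Hermite polynomials are total in `L²` of the Gaussian measure. -/
theorem dense_span_hermitePsi (hS : S.PosDef) :
    Dense (Submodule.span ℝ (Set.range fun j => (memLp_hermitePsi hS j).toLp (hermitePsi S j)) :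
      Set (Lp ℝ 2 (multivariateGaussian 0 S))) := by
  rw [Submodule.dense_iff_topologicalClosure_eq_top, Submodule.topologicalClosure_eq_top_iff,
    Submodule.eq_bot_iff]
  intro u hu
  have hmem := Lp.memLp u
  have hpoly : ∀ p : MvPolynomial (Fin N) ℝ,
      ∫ x, u x * MvPolynomial.eval (fun i => x i) p ∂(multivariateGaussian 0 S) = 0 := by
    intro p
    have h := (Submodule.mem_orthogonal' _ _).1 hu _ (polynomialToLp_mem_span hS p)
    rw [← Lp.toLp_coeFn u hmem] at h
    exact (inner_toLp hmem (memLp_mvPolynomial_eval _ p 2 (by simp))).symm.trans h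
  rw [Lp.eq_zero_iff_ae_eq_zero]
  refine ae_eq_zero_of_integral_mul_pow_dual_eq_zero hmem fun L n => ?_
  -- In coordinates, a power of a linear form is a polynomial.
  rw [← hpoly ((∑ i, MvPolynomial.C (L (EuclideanSpace.single i 1)) * MvPolynomial.X i) ^ n)]
  refine integral_congr_ae (.of_forall fun x => ?_)
  have hx : L x = ∑ i, L (EuclideanSpace.single i 1) * x i := by
    conv_lhs => rw [← (EuclideanSpace.basisFun (Fin N) ℝ).sum_repr x]
    simp [map_sum, mul_comm]
  simp only [map_pow, map_sum, map_mul, MvPolynomial.eval_C, MvPolynomial.eval_X, hx]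

end HermiteExpansion

/-! ### The expansion theorem -/

theorem theorem14 {N : ℕ} {Ω : Type*} [MeasurableSpace Ω] (P : Measure Ω) [IsProbabilityMeasure P]
    (S : Matrix (Fin N) (Fin N) ℝ) (hS : S.PosDef)
    (X : Ω → EuclideanSpace ℝ (Fin N)) (hX : HasLaw X (multivariateGaussian 0 S) P)
    (y : EuclideanSpace ℝ (Fin N) → ℝ) (hy : AEMeasurable y (P.map X))
    (hyX : MemLp (fun ω => y (X ω)) 2 P) :
    -- all `Ψ_j(X)` are square integrable, so that the expectations below are genuine
    (∀ j : Fin N → ℕ, MemLp (fun ω => hermitePsi S j (X ω)) 2 P) ∧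
    -- the coefficient systems have a solution
    (∃ C : (Fin N → ℕ) → ℝ, SolvesCoefficientSystem P S X y C) ∧
    ∀ C : (Fin N → ℕ) → ℝ,
      -- `C` solves the systems iff the expansion converges to `y(X)` in mean square
      (SolvesCoefficientSystem P S X y C ↔
        Tendsto (fun m : ℕ => eLpNorm (fun ω => y (X ω) - pcePartialSum S C m (X ω)) 2 P)
          atTop (𝓝 0)) ∧
      -- the expansion then converges in probability and in distribution
      (SolvesCoefficientSystem P S X y C →
        TendstoInMeasure P (fun (m : ℕ) ω => pcePartialSum S C m (X ω)) atTop
          (fun ω => y (X ω)) ∧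
        TendstoInDistribution (fun (m : ℕ) ω => pcePartialSum S C m (X ω)) atTop
          (fun ω => y (X ω)) (fun _ => P) P) := by
  set γ := multivariateGaussian 0 S with hγ
  have hmap : P.map X = γ := hX.map_eq
  rw [hmap] at hy
  have hyγ : MemLp y 2 γ := by
    rw [← hmap, memLp_map_measure_iff (by rw [hmap]; exact hy.aestronglyMeasurable)
      hX.aemeasurable]
    exact hyX
  have hψγ := fun j => memLp_hermitePsi hS j
  have hcomp : ∀ {f : EuclideanSpace ℝ (Fin N) → ℝ}, MemLp f 2 γ →
      MemLp (fun ω => f (X ω)) 2 P := fun {f} hf => by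
    rw [← hmap] at hf
    exact (memLp_map_measure_iff hf.1 hX.aemeasurable).1 hf
  have hint : ∀ {f g : EuclideanSpace ℝ (Fin N) → ℝ} (hf : MemLp f 2 γ) (hg : MemLp g 2 γ),
      ∫ ω, f (X ω) * g (X ω) ∂P = inner ℝ (hf.toLp f) (hg.toLp g) := by
    intro f g hf hg
    have hfg : AEStronglyMeasurable (fun x => f x * g x) (P.map X) := by
      rw [hmap]; exact hf.1.mul hg.1
    rw [inner_toLp, ← hmap, integral_map hX.aemeasurable hfg]
  have hSm : ∀ C m, MemLp (pcePartialSum S C m) 2 γ := fun C m => by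
    unfold pcePartialSum
    exact memLp_finsetSum _ fun l _ => memLp_finsetSum _ fun j _ => (hψγ j).const_mul _
  have hsum : ∀ C m, (hSm C m).toLp _ =
      ∑ l ∈ Finset.range (m + 1), ∑ j ∈ multiIndices N l, C j • (hψγ j).toLp _ := by
    intro C m
    have h : ∀ l, MemLp (fun x => ∑ j ∈ multiIndices N l, C j * hermitePsi S j x) 2 γ :=
      fun l => memLp_finsetSum _ fun j _ => (hψγ j).const_mul _
    refine (toLp_sum h (Finset.range (m + 1))).trans (Finset.sum_congr rfl fun l _ => ?_)
    exact (toLp_sum (fun j => (hψγ j).const_mul (C j)) (multiIndices N l)).trans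
      (Finset.sum_congr rfl fun j _ => MemLp.toLp_const_smul (C j) (hψγ j))
  -- Expectations under `P` become inner products in `L²(γ)`, turning the coefficient equations into
  -- Gram systems.
  have hsys : ∀ C, SolvesCoefficientSystem P S X y C ↔ ∀ j : Fin N → ℕ,
      ∑ k ∈ multiIndices N (∑ i, j i),
        C k * inner ℝ ((hψγ j).toLp (hermitePsi S j)) ((hψγ k).toLp (hermitePsi S k)) =
      inner ℝ (hyγ.toLp y) ((hψγ j).toLp (hermitePsi S j)) := fun C => by
    simp only [SolvesCoefficientSystem, hint hyγ (hψγ _), hint (hψγ _) (hψγ _)]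
  have hiff : ∀ C, SolvesCoefficientSystem P S X y C ↔
      Tendsto (fun m : ℕ => eLpNorm (fun ω => y (X ω) - pcePartialSum S C m (X ω)) 2 P)
        atTop (𝓝 0) := by
    intro C
    rw [hsys, gram_system_iff_tendsto (d := fun j : Fin N → ℕ => ∑ i, j i) mem_multiIndices
      (fun j k hjk => by
        rw [inner_toLp]; exact integral_hermitePsi_mul_eq_zero hS hjk)
      (dense_span_hermitePsi hS) (hyγ.toLp y) C, tendsto_iff_edist_tendsto_0]
    refine tendsto_congr fun m => ?_
    rw [← hsum, edist_comm, Lp.edist_toLp_toLp]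
    -- The `L²(γ)` distance is the mean square error under `P`, since γ is the law of `X`.
    have h := eLpNorm_map_measure (μ := P) (f := X) (p := 2) (g := y - pcePartialSum S C m)
      (by rw [hmap]; exact hyγ.1.sub (hSm C m).1) hX.aemeasurable
    rw [hmap] at h
    exact h
  refine ⟨fun j => hcomp (hψγ j), ?_, fun C => ⟨hiff C, fun hC => ?_⟩⟩
  · simp only [hsys]
    exact exists_gram_solution mem_multiIndices _ _
  · have hmeas : TendstoInMeasure P (fun (m : ℕ) ω => pcePartialSum S C m (X ω)) atTop
        (fun ω => y (X ω)) := by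
      refine tendstoInMeasure_of_tendsto_eLpNorm (p := 2) (by simp)
        (fun m => (hcomp (hSm C m)).1) hyX.1 (((hiff C).1 hC).congr fun m => ?_)
      exact eLpNorm_sub_comm (fun ω => y (X ω)) (fun ω => pcePartialSum S C m (X ω)) 2 P
    exact ⟨hmeas, hmeas.tendstoInDistribution fun m => (hcomp (hSm C m)).1.aemeasurable⟩
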